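/- Let $T\ge 2$ be the number of periods, let $L\ge 1$ and $1\le \ell\le T-1$ be integers (minimum-up and minimum-down times), and let $\underline C,\overline C,\overline V,V$ be real numbers with $0\le\underline C\le\overline V\le\overline C$ and $V>0$. Let $P$ be the set of all $(x,y,u)\in\mathbb R_+^{T}\times\{0,1\}^{T}\times\{0,1\}^{T-1}$, with $x=(x_1,\dots,x_T)$, $y=(y_1,\dots,y_T)$, $u=(u_2,\dots,u_T)$, such that $$\sum_{i=t-L+1}^{t}u_i\le y_t\ \ (L+1\le t\le T),\qquad \sum_{i=t-\ell+1}^{t}u_i\le 1-y_{t-\ell}\ \ (\ell+1\le t\le T),$$ $$y_t-y_{t-1}-u_t\le 0\ \ (2\le t\le T),\qquad \underline C\,y_t\le x_t\le\overline C\,y_t\ \ (1\le t\le T),$$ $$x_t-x_{t-1}\le Vy_{t-1}+\overline V(1-y_{t-1}),\qquad x_{t-1}-x_t\le Vy_t+\overline V(1-y_t)\ \ (2\le t\le T).$$ Write $[a]^+=\max\{a,0\}$. Let $t,m,n$ be integers and $S$ a set of integers such that $L+1\le t\le T$; $0\le m\le \min\{t-L-1,\ (\overline C-\overline V)/V-L+1\}$;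 $\min\{1,T-t\}\le n\le\min\{L-1,T-t\}$ if $L\ge 2$ and $n=0$ if $L=1$; $S\subseteq\{t-m+1,\dots,t\}$; and $n\ge (L-1)/2$ in case $n\le T-t-1$. Consider the inequality $$x_t\le \overline V y_t+V\sum_{i\in S}(i-d_i)\Big(y_i-\sum_{j=0}^{L-1}u_{i-j}\Big)+V\sum_{k=1}^{[n-1]^+}\Big(y_{t+k}-\sum_{j=0}^{L-1}u_{t+k-j}\Big)+\alpha V\Big(y_{t+n}-\sum_{j=0}^{L-1}u_{t+n-j}\Big)+\beta\Big(y_{t-m}-\sum_{j=0}^{L-1}u_{t-m-j}\Big)+\phi(u),$$ where $d_i=\max\{a\in S\cup\{t-m\}:a<i\}$ for $i\in S$, $\alpha=m+L-1-\sum_{i\in S}(i-d_i)-[n-1]^+$, $\beta=\overline C-\overline V-(m+L-1)V$, and $$\phi(u)=V\sum_{k=1}^{t+L-T-1}k\,u_{t-k}+V\sum_{k=[t+L-T]^+}^{L-1}\min\{L-1-k,k\}\,u_{t-k}$$ (empty sums are $0$). Then this inequality is valid for $\mathrm{conv}(P)$, and if $\underline C<\overline C$ it is facet-defining for $\mathrm{conv}(P)$,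 i.e. the points of $\mathrm{conv}(P)$ satisfying it with equality form a nonempty face of dimension $\dim\mathrm{conv}(P)-1$. -/

import Mathlib

/-- The data of one machine: number of periods `T`, minimum-up time `L`, minimum-down time `ell`,
generation lower and upper bounds `Clo`, `Chi`, start-up/shut-down ramp rate `Vbar` and
ramp-up and ramp-down rate `V`. -/
structure MachineData where
  T : ℤ
  L : ℤ
  ell : ℤ
  Clo : ℝ
  Chi : ℝ
  Vbar : ℝ
  V : ℝ

/-- The space `ℝ^T × ℝ^T × ℝ^(T-1)` of vectors
`(x, y, u) = ((x_1, …, x_T), (y_1, …, y_T), (u_2, …, u_T))`. -/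
abbrev Schedule (T : ℤ) : Type :=
  (Finset.Icc (1 : ℤ) T → ℝ) × (Finset.Icc (1 : ℤ) T → ℝ) × (Finset.Icc (2 : ℤ) T → ℝ)

/-- The coordinate of index `i` of a vector indexed by a finite set `I` of integers
(`0` if `i ∉ I`). -/
noncomputable def coordAt {I : Finset ℤ} (f : I → ℝ) (i : ℤ) : ℝ :=
  if h : i ∈ I then f ⟨i, h⟩ else 0

/-- The generation amount `x_i`. -/
noncomputable def Schedule.x {T : ℤ} (p : Schedule T) (i : ℤ) : ℝ := coordAt p.1 i

/-- The online status `y_i`. -/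
noncomputable def Schedule.y {T : ℤ} (p : Schedule T) (i : ℤ) : ℝ := coordAt p.2.1 i

/-- The start-up decision `u_i`. -/
noncomputable def Schedule.u {T : ℤ} (p : Schedule T) (i : ℤ) : ℝ := coordAt p.2.2 i

/-- The mixed-integer set `P` of the minimum-up and minimum-down time and ramping constraints. -/
def MachineData.P (D : MachineData) : Set (Schedule D.T) :=
  {p |
    (∀ t ∈ Finset.Icc 1 D.T, 0 ≤ p.x t) ∧
    (∀ t ∈ Finset.Icc 1 D.T, p.y t = 0 ∨ p.y t = 1) ∧
    (∀ t ∈ Finset.Icc 2 D.T, p.u t = 0 ∨ p.u t = 1) ∧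
    -- minimum-up time
    (∀ t ∈ Finset.Icc (D.L + 1) D.T, ∑ i ∈ Finset.Icc (t - D.L + 1) t, p.u i ≤ p.y t) ∧
    -- minimum-down time
    (∀ t ∈ Finset.Icc (D.ell + 1) D.T,
      ∑ i ∈ Finset.Icc (t - D.ell + 1) t, p.u i ≤ 1 - p.y (t - D.ell)) ∧
    -- start-up logic
    (∀ t ∈ Finset.Icc 2 D.T, p.y t - p.y (t - 1) - p.u t ≤ 0) ∧
    -- generation lower and upper bounds
    (∀ t ∈ Finset.Icc 1 D.T, -p.x t + D.Clo * p.y t ≤ 0) ∧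
    (∀ t ∈ Finset.Icc 1 D.T, p.x t - D.Chi * p.y t ≤ 0) ∧
    -- ramp-up and ramp-down limits
    (∀ t ∈ Finset.Icc 2 D.T,
      p.x t - p.x (t - 1) ≤ D.V * p.y (t - 1) + D.Vbar * (1 - p.y (t - 1))) ∧
    (∀ t ∈ Finset.Icc 2 D.T,
      p.x (t - 1) - p.x t ≤ D.V * p.y t + D.Vbar * (1 - p.y t))}

/-- The inequality `f ≤ g` (for affine functions `f`, `g`) is valid for `Q`. -/
def IsValidIneq {E : Type*} (Q : Set E) (f g : E → ℝ) : Prop :=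
  ∀ p ∈ Q, f p ≤ g p

/-- The inequality `f ≤ g` (for affine functions `f`, `g`) is facet-defining for the polytope `Q`:
it is valid, and the face of `Q` on which it holds with equality is nonempty and has dimension
`dim Q - 1`, the dimension being that of the affine hull. -/
def IsFacetDefining {E : Type*} [AddCommGroup E] [Module ℝ E] (Q : Set E) (f g : E → ℝ) : Prop :=
  IsValidIneq Q f g ∧ {p ∈ Q | f p = g p}.Nonempty ∧
    Module.finrank ℝ (vectorSpan ℝ {p ∈ Q | f p = g p}) + 1 =
      Module.finrank ℝ (vectorSpan ℝ Q)

/-- `d_i = max {a ∈ S ∪ {t - m} : a < i}`, for `i > t - m`. -/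
def predIn (S : Finset ℤ) (t m i : ℤ) : ℤ :=
  (insert (t - m) {a ∈ S | a < i}).max' (Finset.insert_nonempty _ _)

/-- The expression `y_i - ∑_{j=0}^{L-1} u_{i-j}`. -/
noncomputable def MachineData.w (D : MachineData) (p : Schedule D.T) (i : ℤ) : ℝ :=
  p.y i - ∑ j ∈ Finset.Icc 0 (D.L - 1), p.u (i - j)

/-- `α(S,t) = m + L - 1 - ∑_{i ∈ S} (i - d_i) - [n-1]^+`. -/
noncomputable def MachineData.alpha (D : MachineData) (t m n : ℤ) (S : Finset ℤ) : ℤ :=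
  m + D.L - 1 - ∑ i ∈ S, (i - predIn S t m i) - max (n - 1) 0

/-- `β(t) = C̄ - V̄ - (m + L - 1) V`. -/
noncomputable def MachineData.beta (D : MachineData) (m : ℤ) : ℝ :=
  D.Chi - D.Vbar - ((m + D.L - 1 : ℤ) : ℝ) * D.V

/-- `φ(u,t) = V ∑_{k=1}^{t+L-T-1} k u_{t-k} + V ∑_{k=[t+L-T]^+}^{L-1} min {L-1-k, k} u_{t-k}`. -/
noncomputable def MachineData.phi (D : MachineData) (p : Schedule D.T) (t : ℤ) : ℝ :=
  D.V * ∑ k ∈ Finset.Icc 1 (t + D.L - D.T - 1), (k : ℝ) * p.u (t - k) +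
  D.V * ∑ k ∈ Finset.Icc (max (t + D.L - D.T) 0) (D.L - 1),
    ((min (D.L - 1 - k) k : ℤ) : ℝ) * p.u (t - k)

/-- The right-hand side of the upper bound on `x_t` given by `t`, `m`, `n` and `S`. -/
noncomputable def MachineData.upperBound (D : MachineData) (t m n : ℤ) (S : Finset ℤ) (p : Schedule D.T) : ℝ :=
  D.Vbar * p.y t
    + D.V * ∑ i ∈ S, ((i - predIn S t m i : ℤ) : ℝ) * D.w p i
    + D.V * ∑ k ∈ Finset.Icc 1 (max (n - 1) 0), D.w p (t + k)
    + (D.alpha t m n S : ℝ) * D.V * D.w p (t + n)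
    + D.beta m * D.w p (t - m)
    + D.phi p t

/-!
A feasible schedule is a union of on-periods, with `u = 1` at each start-up and `u = 0` in the
remaining periods of an on-period. If `[a, b]` is the maximal on-period containing `t`, then
`w_i = 1` for the `i ∈ [a, b]` with `i ≥ a + L`, and all other terms of the bound are nonnegative. Hence the bound is at least its value for the
schedule whose only on-period is `[a, b]`, which is `V̄ + V * rise a b`, plus `β` if
`a + L ≤ t - m`. The gaps `i - d_i` telescope (`sum_gap_ge`), so `rise` has a closed form
(`rise_eq`), and a case distinction (`rise_ge`) compares it with the ramp-up steps `t - a`, the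
ramp-down steps `b - t` and the capacity `C̄`. This proves validity, first on `P` and then, by
linearity, on its convex hull.

The zero schedule lies on the face, so the face spans a linear subspace of the kernel of `slack`,
the difference of the two sides. To see that it spans this kernel, let a linear functional vanish on
the face and at one feasible point off it; it has to be zero (`eq_zero_of_forall_tight`). The
always-on schedules at full capacity, with a small decrease in one period, show that it does not
depend on `x` and that the coefficients of `y` sum to zero. Schedules with a single on-period
`[a, b]` and the largest generation allowed (`onPoint`) give `F b - F (a - 1) + C a = 0` whenever
they are tight, where `F` are the prefix sums of the coefficients of `y` and `C` the coefficients of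
`u`. Enough on-periods are tight to force `F = 0` and `C = 0` (`eq_zero_of_tight`). So the face
spans the hyperplane `ker slack`, and together with the feasible point off the face this makes
`conv P` full-dimensional.
-/

/-! ### Admissible parameters and the telescoping sum -/

namespace MachineData

/-- The standing assumptions on the machine and on the parameters `t`, `m`, `n`, `S` of the
inequality, with the conditions on `m` and `n` in division-free form. -/
structure IsAdmissible (D : MachineData) (t m n : ℤ) (S : Finset ℤ) : Prop where
  one_le_L : 1 ≤ D.L
  one_le_ell : 1 ≤ D.ell
  ell_lt_T : D.ell + 1 ≤ D.T
  Clo_nonneg : 0 ≤ D.Clo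
  Clo_le_Vbar : D.Clo ≤ D.Vbar
  Vbar_le_Chi : D.Vbar ≤ D.Chi
  V_pos : 0 < D.V
  L_lt_t : D.L + 1 ≤ t
  t_le_T : t ≤ D.T
  m_nonneg : 0 ≤ m
  L_lt_sub : D.L + 1 ≤ t - m
  beta_nonneg : 0 ≤ D.beta m
  n_nonneg : 0 ≤ n
  n_le_L : n ≤ D.L - 1
  n_le_T : t + n ≤ D.T
  n_half : t + n + 1 ≤ D.T → D.L - 1 ≤ 2 * n
  lt_of_mem : ∀ i ∈ S, t - m < i
  le_of_mem : ∀ i ∈ S, i ≤ t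

end MachineData

theorem le_predIn (S : Finset ℤ) (t m c : ℤ) : t - m ≤ predIn S t m c :=
  Finset.le_max' _ _ (Finset.mem_insert_self _ _)

theorem le_predIn_of_mem {S : Finset ℤ} {t m c i : ℤ} (hi : i ∈ S) (hc : i < c) :
    i ≤ predIn S t m c :=
  Finset.le_max' _ _ (Finset.mem_insert_of_mem (Finset.mem_filter.2 ⟨hi, hc⟩))

theorem predIn_le {S : Finset ℤ} {t m c d : ℤ} (hd : t - m ≤ d)
    (h : ∀ i ∈ S, i < c → i ≤ d) : predIn S t m c ≤ d := by
  refine Finset.max'_le _ _ _ fun i hi => ?_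
  rcases Finset.mem_insert.1 hi with rfl | hi
  · exact hd
  · exact h i (Finset.mem_filter.1 hi).1 (Finset.mem_filter.1 hi).2

theorem predIn_congr {S : Finset ℤ} {t m c d : ℤ} (h : ∀ i ∈ S, i < c ↔ i < d) :
    predIn S t m c = predIn S t m d :=
  le_antisymm (predIn_le (le_predIn _ _ _ _) fun i hi hc => le_predIn_of_mem hi ((h i hi).1 hc))
    (predIn_le (le_predIn _ _ _ _) fun i hi hc => le_predIn_of_mem hi ((h i hi).2 hc))

theorem predIn_lt {S : Finset ℤ} {t m c : ℤ} (hc : t - m < c) : predIn S t m c < c := by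
  have : predIn S t m c ≤ c - 1 := predIn_le (by omega) fun i _ _ => by omega
  omega

/-- The gaps `i - d_i` of the elements of `S` below `c` telescope. -/
theorem sum_gap_lt {S : Finset ℤ} {t m : ℤ} (hS : ∀ i ∈ S, t - m < i) (c : ℤ) :
    ∑ i ∈ S with i < c, (i - predIn S t m i) = predIn S t m c - (t - m) := by
  rcases le_total c (t - m) with hc | hc
  · have h1 : predIn S t m c = t - m :=
      le_antisymm (predIn_le le_rfl fun i hi h => by have := hS i hi; omega) (le_predIn _ _ _ _)
    rw [Finset.filter_false_of_mem fun i hi => by have := hS i hi; omega, h1]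
    simp
  · induction c, hc using Int.leInduction with
    | base =>
      have h1 : predIn S t m (t - m) = t - m :=
        le_antisymm (predIn_le le_rfl fun i hi h => h.le) (le_predIn _ _ _ _)
      rw [Finset.filter_false_of_mem fun i hi => by have := hS i hi; omega, h1]
      simp
    | succ c hc ih =>
      by_cases hcS : c ∈ S
      · have h1 : {i ∈ S | i < c + 1} = insert c {i ∈ S | i < c} := by
          ext i
          simp only [Finset.mem_filter, Finset.mem_insert]
          constructor
          · rintro ⟨h, h'⟩
            by_cases hic : i = c
            · exact Or.inl hic
            · exact Or.inr ⟨h, by omega⟩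
          · rintro (rfl | ⟨h, h'⟩)
            · exact ⟨hcS, by omega⟩
            · exact ⟨h, by omega⟩
        have h2 : predIn S t m (c + 1) = c :=
          le_antisymm (predIn_le hc fun i _ h => by omega) (le_predIn_of_mem hcS (by omega))
        rw [h1, Finset.sum_insert (by simp), ih, h2]
        ring
      · have h1 : ∀ i ∈ S, i < c + 1 ↔ i < c := fun i hi => by
          have : i ≠ c := fun h => hcS (h ▸ hi)
          omega
        rw [Finset.filter_congr h1, ih, predIn_congr h1]

/-- The gaps of the elements of `S` from `c` on. -/
theorem sum_gap_ge {S : Finset ℤ} {t m : ℤ} (hS : ∀ i ∈ S, t - m < i) (hS' : ∀ i ∈ S, i ≤ t)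
    (c : ℤ) :
    ∑ i ∈ S with c ≤ i, (i - predIn S t m i) = predIn S t m (t + 1) - predIn S t m c := by
  have h1 := sum_gap_lt hS (t + 1)
  have h2 := sum_gap_lt hS c
  rw [Finset.filter_true_of_mem fun i hi => by have := hS' i hi; omega] at h1
  have h3 := Finset.sum_filter_add_sum_filter_not S (fun i => c ≤ i) (fun i => i - predIn S t m i)
  simp only [not_le] at h3
  omega

/-- Counting the `k` in `{1, …, N}` for which `t + k` lies in `[c, b]`. -/
theorem sum_ite_mem_Icc (N t c b : ℤ) :
    ∑ k ∈ Finset.Icc 1 N, (if c ≤ t + k ∧ t + k ≤ b then (1 : ℤ) else 0) =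
      max 0 (min N (b - t) - max 1 (c - t) + 1) := by
  rw [← Finset.sum_filter]
  have : {k ∈ Finset.Icc 1 N | c ≤ t + k ∧ t + k ≤ b} =
      Finset.Icc (max 1 (c - t)) (min N (b - t)) := by
    ext k
    simp only [Finset.mem_filter, Finset.mem_Icc]
    omega
  rw [this, Finset.sum_const, Int.card_Icc]
  simp only [nsmul_eq_mul, mul_one]
  omega

namespace MachineData

/-- The coefficient of `V * u_{t-k}` in `φ`. -/
def phiCoeff (D : MachineData) (t k : ℤ) : ℤ :=
  (if 1 ≤ k ∧ k ≤ t + D.L - D.T - 1 then k else 0) +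
    (if max (t + D.L - D.T) 0 ≤ k ∧ k ≤ D.L - 1 then min (D.L - 1 - k) k else 0)

theorem phiCoeff_nonneg (D : MachineData) (t k : ℤ) : 0 ≤ D.phiCoeff t k := by
  unfold phiCoeff
  split_ifs <;> omega

/-- The value of `(upperBound - V̄ y_t - β w_{t-m}) / V` on a schedule whose only on-period is
`[a, b]`. Here `a ≤ 1` stands for a machine that is on from the beginning, and `b ≥ T` for one that
is never shut down. -/
noncomputable def rise (D : MachineData) (t m n : ℤ) (S : Finset ℤ) (a b : ℤ) : ℤ :=
  ∑ i ∈ S, (if a + D.L ≤ i ∧ i ≤ b then i - predIn S t m i else 0) +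
    ∑ k ∈ Finset.Icc 1 (max (n - 1) 0), (if a + D.L ≤ t + k ∧ t + k ≤ b then 1 else 0) +
    (if a + D.L ≤ t + n ∧ t + n ≤ b then D.alpha t m n S else 0) + D.phiCoeff t (t - a)

namespace IsAdmissible

variable {D : MachineData} {t m n : ℤ} {S : Finset ℤ}

theorem alpha_eq (h : D.IsAdmissible t m n S) :
    D.alpha t m n S = t - predIn S t m (t + 1) + D.L - 1 - max (n - 1) 0 := by
  have h1 := sum_gap_lt h.lt_of_mem (t + 1)
  rw [Finset.filter_true_of_mem fun i hi => by have := h.le_of_mem i hi; omega] at h1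
  unfold alpha
  omega

/-- Closed form of `rise` when the on-period does not end before `t`: both sums are evaluated, the
first one by telescoping. -/
theorem rise_eq (h : D.IsAdmissible t m n S) {a b : ℤ} (hb : t ≤ b) :
    D.rise t m n S a b = predIn S t m (t + 1) - predIn S t m (a + D.L) +
      max 0 (min (max (n - 1) 0) (b - t) - max 1 (a + D.L - t) + 1) +
      (if a + D.L ≤ t + n ∧ t + n ≤ b then
        t - predIn S t m (t + 1) + D.L - 1 - max (n - 1) 0 else 0) + D.phiCoeff t (t - a) := by
  have h1 : ∑ i ∈ S, (if a + D.L ≤ i ∧ i ≤ b then i - predIn S t m i else 0) =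
      predIn S t m (t + 1) - predIn S t m (a + D.L) := by
    rw [← sum_gap_ge h.lt_of_mem h.le_of_mem, ← Finset.sum_filter]
    refine Finset.sum_congr (Finset.filter_congr fun i hi => ?_) fun _ _ => rfl
    have := h.le_of_mem i hi
    omega
  rw [rise, h1, sum_ite_mem_Icc, h.alpha_eq]

theorem predIn_le_top (h : D.IsAdmissible t m n S) (c : ℤ) :
    predIn S t m c ≤ predIn S t m (t + 1) :=
  predIn_le (le_predIn _ _ _ _) fun i hi _ =>
    le_predIn_of_mem hi (by have := h.le_of_mem i hi; omega)

theorem predIn_top_le (h : D.IsAdmissible t m n S) : predIn S t m (t + 1) ≤ t :=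
  predIn_le (by have := h.m_nonneg; omega) fun i hi _ => h.le_of_mem i hi

theorem predIn_of_lt (h : D.IsAdmissible t m n S) {c : ℤ} (hc : t < c) :
    predIn S t m c = predIn S t m (t + 1) :=
  predIn_congr fun i hi => by have := h.le_of_mem i hi; omega

theorem predIn_of_le (h : D.IsAdmissible t m n S) {c : ℤ} (hc : c ≤ t - m) :
    predIn S t m c = t - m :=
  le_antisymm (predIn_le le_rfl fun i hi _ => by have := h.lt_of_mem i hi; omega)
    (le_predIn _ _ _ _)

theorem predIn_succ (h : D.IsAdmissible t m n S) {i : ℤ} (hi : i ∈ S ∨ i = t - m) :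
    predIn S t m (i + 1) = i := by
  have h1 : t - m ≤ predIn S t m (i + 1) := le_predIn _ _ _ _
  rcases hi with hi | rfl
  · have h2 : i ≤ predIn S t m (i + 1) := le_predIn_of_mem hi (by omega)
    have h3 := h.lt_of_mem i hi
    exact le_antisymm (predIn_le h3.le fun j _ _ => by omega) h2
  · exact le_antisymm (predIn_le le_rfl fun j _ _ => by omega) h1

theorem alpha_nonneg (h : D.IsAdmissible t m n S) : 0 ≤ D.alpha t m n S := by
  have := h.alpha_eq
  have := h.predIn_top_le
  have := h.n_le_L
  have := h.one_le_L
  omega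

/-- The case distinction behind validity: `rise` is at least the number of ramp-up steps since the
start-up, or the number of ramp-down steps until the shut-down, or, with the coefficient `β`
present, the number of steps that `β` completes to the capacity. -/
theorem rise_ge (h : D.IsAdmissible t m n S) {a b : ℤ} (ha : a ≤ t) (hb : t ≤ b)
    (hbT : b ≤ D.T) (hab : 2 ≤ a → b < D.T → a + D.L ≤ b + 1) :
    (2 ≤ a ∧ t - a ≤ D.rise t m n S a b) ∨ (b < D.T ∧ b - t ≤ D.rise t m n S a b) ∨
      (a + D.L ≤ t - m ∧ m + D.L - 1 ≤ D.rise t m n S a b) := by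
  have h1 := h.rise_eq (a := a) hb
  have h2 := h.predIn_le_top (a + D.L)
  have h3 := h.predIn_top_le
  have h4 := le_predIn S t m (a + D.L)
  have h5 : t - m < a + D.L → predIn S t m (a + D.L) < a + D.L := predIn_lt
  have h6 : t < a + D.L → predIn S t m (a + D.L) = predIn S t m (t + 1) := h.predIn_of_lt
  have h7 : a + D.L ≤ t - m → predIn S t m (a + D.L) = t - m := h.predIn_of_le
  obtain ⟨hL, _, _, _, _, _, _, hLt, htT, hm, hLm, _, hn, hnL, hnT, hnh, _, _⟩ := h
  generalize D.rise t m n S a b = R at *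
  generalize predIn S t m (a + D.L) = p at *
  generalize predIn S t m (t + 1) = M at *
  unfold phiCoeff at h1
  generalize D.L = L at *
  generalize D.T = T at *
  by_cases c1 : t < a + L
  · by_cases c2 : a + L ≤ t + n ∧ t + n ≤ b
    · rw [if_pos c2] at h1
      split_ifs at h1 <;> omega
    · rw [if_neg c2] at h1
      split_ifs at h1 <;> omega
  · by_cases c2 : a + L ≤ t + n ∧ t + n ≤ b
    · rw [if_pos c2] at h1
      split_ifs at h1 <;> omega
    · rw [if_neg c2] at h1
      split_ifs at h1 <;> omega

end IsAdmissible
end MachineData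

namespace MachineData
namespace IsAdmissible
variable {D : MachineData} {t m n : ℤ} {S : Finset ℤ}

/-! ### On-periods on which the bound is tight -/

/-- A machine started `L - 1` periods before an element of `S ∪ {t - m}` and then kept on. -/
theorem rise_eq_of_mem (h : D.IsAdmissible t m n S) {i b : ℤ} (hi : i ∈ S ∨ i = t - m)
    (hit : i < t ∨ i = t ∧ 1 ≤ n) (hb : D.T ≤ b) :
    D.rise t m n S (i - D.L + 1) b = t - (i - D.L + 1) := by
  have h1 := h.rise_eq (a := i - D.L + 1) (b := b) (by have := h.t_le_T; omega)
  rw [show i - D.L + 1 + D.L = i + 1 by ring, h.predIn_succ hi] at h1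
  have h2 : i ≤ predIn S t m (t + 1) := h.predIn_succ hi ▸ h.predIn_le_top (i + 1)
  have h3 := h.predIn_top_le
  have h6 : t < i + 1 → i = predIn S t m (t + 1) := fun h' => by
    rw [← h.predIn_of_lt h', h.predIn_succ hi]
  obtain ⟨hL, _, _, _, _, _, _, hLt, htT, hm, hLm, _, hn, hnL, hnT, hnh, _, _⟩ := h
  generalize D.rise t m n S _ b = R at *
  generalize predIn S t m (t + 1) = M at *
  unfold phiCoeff at h1
  generalize D.L = L at *
  generalize D.T = T at *
  rw [if_pos (by omega)] at h1
  split_ifs at h1 <;> omega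

/-- A machine whose minimum-up time ends in period `t + n < T`; the condition `(L - 1) / 2 ≤ n`
enters here. -/
theorem rise_eq_of_up_end (h : D.IsAdmissible t m n S) {b : ℤ} (hnT : t + n + 1 ≤ D.T)
    (hb : t + n ≤ b) :
    D.rise t m n S (t + n + 1 - D.L) b = t - (t + n + 1 - D.L) := by
  have h1 := h.rise_eq (a := t + n + 1 - D.L) (b := b) (by have := h.n_nonneg; omega)
  rw [show t + n + 1 - D.L + D.L = t + n + 1 by ring,
    h.predIn_of_lt (c := t + n + 1) (by have := h.n_nonneg; omega)] at h1
  obtain ⟨hL, _, _, _, _, _, _, hLt, htT, hm, hLm, _, hn, hnL, _, hnh, _, _⟩ := h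
  generalize D.rise t m n S _ b = R at *
  unfold phiCoeff at h1
  generalize D.L = L at *
  generalize D.T = T at *
  rw [if_neg (by omega)] at h1
  split_ifs at h1 <;> omega

/-- A machine started in period `t - L + 1` and shut down after period `t + r`, with `r < n`. -/
theorem rise_eq_of_shutdown (h : D.IsAdmissible t m n S) {r : ℤ} (hr : 0 ≤ r) (hrn : r < n) :
    D.rise t m n S (t - D.L + 1) (t + r) = r := by
  have h1 := h.rise_eq (a := t - D.L + 1) (b := t + r) (by omega)
  rw [show t - D.L + 1 + D.L = t + 1 by ring] at h1
  obtain ⟨hL, _, _, _, _, _, _, hLt, htT, hm, hLm, _, hn, hnL, hnT, hnh, _, _⟩ := h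
  generalize D.rise t m n S _ _ = R at *
  unfold phiCoeff at h1
  generalize D.L = L at *
  generalize D.T = T at *
  rw [if_neg (by omega)] at h1
  split_ifs at h1 <;> omega

/-- A machine on exactly in the periods `t - L, …, t`, when `t ∉ S`. -/
theorem rise_eq_of_notMem (h : D.IsAdmissible t m n S) (htS : t ∉ S) (hn1 : 1 ≤ n) :
    D.rise t m n S (t - D.L) t = 0 := by
  have h1 := h.rise_eq (a := t - D.L) (b := t) le_rfl
  have h2 : predIn S t m t = predIn S t m (t + 1) := predIn_congr fun i hi => by
    have := h.le_of_mem i hi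
    have : i ≠ t := fun h => htS (h ▸ hi)
    omega
  rw [show t - D.L + D.L = t by ring, h2] at h1
  obtain ⟨hL, _, _, _, _, _, _, hLt, htT, hm, hLm, _, hn, hnL, hnT, hnh, _, _⟩ := h
  generalize D.rise t m n S _ _ = R at *
  unfold phiCoeff at h1
  generalize D.L = L at *
  generalize D.T = T at *
  rw [if_neg (by omega)] at h1
  split_ifs at h1 <;> omega

/-- A machine with period `t` in its minimum-up time, ending before period `T`, and is
shut down as early as possible. -/
theorem rise_eq_of_min_up (h : D.IsAdmissible t m n S) {a : ℤ} (ha : t - D.L < a) (hat : a ≤ t)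
    (haT : a + D.L ≤ D.T) :
    D.rise t m n S a (a + D.L - 1) = min (t - a) (a + D.L - 1 - t) := by
  have h1 := h.rise_eq (a := a) (b := a + D.L - 1) (by omega)
  rw [h.predIn_of_lt (c := a + D.L) (by omega)] at h1
  obtain ⟨hL, _, _, _, _, _, _, hLt, htT, hm, hLm, _, hn, hnL, hnT, hnh, _, _⟩ := h
  generalize D.rise t m n S _ _ = R at *
  unfold phiCoeff at h1
  generalize D.L = L at *
  generalize D.T = T at *
  rw [if_neg (by omega)] at h1
  split_ifs at h1 <;> omega

/-- A machine with period `t` in its minimum-up time, which lasts beyond period `T`. -/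
theorem rise_eq_of_late (h : D.IsAdmissible t m n S) {a b : ℤ} (hat : a ≤ t)
    (haT : D.T < a + D.L) (hb : D.T ≤ b) :
    D.rise t m n S a b = t - a := by
  have h1 := h.rise_eq (a := a) (b := b) (by have := h.t_le_T; omega)
  rw [h.predIn_of_lt (c := a + D.L) (by have := h.t_le_T; omega)] at h1
  obtain ⟨hL, _, _, _, _, _, _, hLt, htT, hm, hLm, _, hn, hnL, hnT, hnh, _, _⟩ := h
  generalize D.rise t m n S _ _ = R at *
  unfold phiCoeff at h1
  generalize D.L = L at *
  generalize D.T = T at *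
  rw [if_neg (by omega)] at h1
  split_ifs at h1 <;> omega

/-- A machine shut down before period `t`, whose on-period avoids `S` once its minimum-up time is
over. -/
theorem rise_eq_zero_of_lt (h : D.IsAdmissible t m n S) {a b : ℤ} (hbt : b < t)
    (hat : D.L ≤ t - a) (hS : ∀ i ∈ S, ¬ (a + D.L ≤ i ∧ i ≤ b)) :
    D.rise t m n S a b = 0 := by
  have hn := h.n_nonneg
  rw [rise, Finset.sum_eq_zero fun i hi => if_neg (hS i hi), Finset.sum_eq_zero fun k hk => ?_,
    if_neg (by omega), phiCoeff, if_neg (by have := h.t_le_T; omega), if_neg (by omega)]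
  · rfl
  · have := Finset.mem_Icc.1 hk
    exact if_neg (by omega)

end IsAdmissible

/-! ### Schedules with one on-period -/

variable (D : MachineData)

/-- The schedule that is on exactly in the periods of `[a, b]` and generates as much as the ramping
limits at both ends of `[a, b]` and the capacity allow. The ends may lie outside `[1, T]`: with `a`
far below `1` and `b` far above `T` the ramping limits have no effect. -/
noncomputable def onPoint (a b : ℤ) : Schedule D.T :=
  (fun j => if a ≤ (j : ℤ) ∧ (j : ℤ) ≤ b then
      min D.Chi (min (D.Vbar + ((j : ℤ) - a : ℝ) * D.V) (D.Vbar + (b - (j : ℤ) : ℝ) * D.V)) else 0,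
    fun j => if a ≤ (j : ℤ) ∧ (j : ℤ) ≤ b then 1 else 0,
    fun j => if (j : ℤ) = a then 1 else 0)

variable {D}

theorem onPoint_x {a b j : ℤ} (h1 : 1 ≤ j) (hT : j ≤ D.T) :
    (D.onPoint a b).x j = if a ≤ j ∧ j ≤ b then
      min D.Chi (min (D.Vbar + (j - a : ℝ) * D.V) (D.Vbar + (b - j : ℝ) * D.V)) else 0 := by
  simp [Schedule.x, coordAt, onPoint, h1, hT]

theorem onPoint_y {a b j : ℤ} (h1 : 1 ≤ j) (hT : j ≤ D.T) :
    (D.onPoint a b).y j = if a ≤ j ∧ j ≤ b then 1 else 0 := by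
  simp [Schedule.y, coordAt, onPoint, h1, hT]

theorem onPoint_u {a b j : ℤ} (h1 : 2 ≤ j) (hT : j ≤ D.T) :
    (D.onPoint a b).u j = if j = a then 1 else 0 := by
  simp [Schedule.u, coordAt, onPoint, h1, hT]

theorem onPoint_sum_u {a b c d : ℤ} (h1 : 2 ≤ c) (hT : d ≤ D.T) :
    ∑ i ∈ Finset.Icc c d, (D.onPoint a b).u i = if c ≤ a ∧ a ≤ d then 1 else 0 := by
  rw [Finset.sum_congr rfl fun i hi => onPoint_u (by have := Finset.mem_Icc.1 hi; omega)
    (by have := Finset.mem_Icc.1 hi; omega)]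
  simp

theorem sum_Icc_u_sub (p : Schedule D.T) (L i : ℤ) :
    ∑ j ∈ Finset.Icc 0 (L - 1), p.u (i - j) = ∑ j ∈ Finset.Icc (i - L + 1) i, p.u j := by
  refine Finset.sum_bij' (fun j _ => i - j) (fun j _ => i - j) ?_ ?_ ?_ ?_ ?_ <;>
    simp only [Finset.mem_Icc, sub_sub_cancel, implies_true] <;> omega

theorem onPoint_w {a b i : ℤ} (hab : a + D.L ≤ b + 1) (hL : 1 ≤ D.L) (hi : D.L + 1 ≤ i)
    (hT : i ≤ D.T) : D.w (D.onPoint a b) i = if a + D.L ≤ i ∧ i ≤ b then 1 else 0 := by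
  rw [w, sum_Icc_u_sub, onPoint_sum_u (by omega) hT, onPoint_y (by omega) hT]
  split_ifs <;> first | omega | norm_num

theorem phi_eq (p : Schedule D.T) {t : ℤ} (htT : t ≤ D.T) :
    D.phi p t = D.V * ∑ k ∈ Finset.Icc 0 (D.L - 1), (D.phiCoeff t k : ℝ) * p.u (t - k) := by
  have h1 : Finset.Icc 1 (t + D.L - D.T - 1) =
      {k ∈ Finset.Icc 0 (D.L - 1) | 1 ≤ k ∧ k ≤ t + D.L - D.T - 1} := by
    ext k; simp only [Finset.mem_filter, Finset.mem_Icc]; omega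
  have h2 : Finset.Icc (max (t + D.L - D.T) 0) (D.L - 1) =
      {k ∈ Finset.Icc 0 (D.L - 1) | max (t + D.L - D.T) 0 ≤ k ∧ k ≤ D.L - 1} := by
    ext k; simp only [Finset.mem_filter, Finset.mem_Icc]; omega
  rw [phi, h1, h2, Finset.sum_filter, Finset.sum_filter, ← mul_add, ← Finset.sum_add_distrib]
  congr 1
  refine Finset.sum_congr rfl fun k _ => ?_
  unfold phiCoeff
  split_ifs <;> push_cast <;> ring

theorem phiCoeff_eq_zero {t k : ℤ} (htT : t ≤ D.T) (hk : k < 0 ∨ D.L ≤ k) :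
    D.phiCoeff t k = 0 := by
  rw [phiCoeff, if_neg (by omega), if_neg (by omega), add_zero]

theorem onPoint_phi {a b t : ℤ} (htT : t ≤ D.T) (hLt : D.L + 1 ≤ t) :
    D.phi (D.onPoint a b) t = D.V * (D.phiCoeff t (t - a) : ℝ) := by
  rw [phi_eq _ htT]
  congr 1
  have h1 : ∀ k ∈ Finset.Icc 0 (D.L - 1), (D.phiCoeff t k : ℝ) * (D.onPoint a b).u (t - k) =
      if t - a = k then (D.phiCoeff t (t - a) : ℝ) else 0 := fun k hk => by
    have := Finset.mem_Icc.1 hk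
    rw [onPoint_u (by omega) (by omega)]
    by_cases h : t - a = k
    · rw [if_pos (by omega), if_pos h, h, mul_one]
    · rw [if_neg (by omega), if_neg h, mul_zero]
  rw [Finset.sum_congr rfl h1, Finset.sum_ite_eq]
  split_ifs with h
  · rfl
  · rw [Finset.mem_Icc] at h
    rw [phiCoeff_eq_zero htT (by omega), Int.cast_zero]

/-- The bound on a schedule with one on-period. -/
theorem IsAdmissible.upperBound_onPoint {t m n : ℤ} {S : Finset ℤ} (h : D.IsAdmissible t m n S)
    {a b : ℤ} (hab : a + D.L ≤ b + 1) :
    D.upperBound t m n S (D.onPoint a b) = D.Vbar * (if a ≤ t ∧ t ≤ b then 1 else 0) +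
      D.V * D.rise t m n S a b + D.beta m * (if a + D.L ≤ t - m ∧ t - m ≤ b then 1 else 0) := by
  have hL := h.one_le_L
  have hn := h.n_nonneg
  have hnT := h.n_le_T
  have hLt := h.L_lt_t
  have hLm := h.L_lt_sub
  have hm := h.m_nonneg
  have htT := h.t_le_T
  rw [upperBound, rise, onPoint_y (by omega) htT, onPoint_phi htT hLt,
    onPoint_w hab hL (i := t + n) (by omega) hnT,
    onPoint_w hab hL (i := t - m) hLm (by omega),
    Finset.sum_congr rfl fun i hi => by
      rw [onPoint_w hab hL (by have := h.lt_of_mem i hi; omega)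
        (by have := h.le_of_mem i hi; omega)],
    Finset.sum_congr (s₁ := Finset.Icc 1 _) rfl fun k hk => by
      have := Finset.mem_Icc.1 hk
      rw [onPoint_w hab hL (by omega) (by omega)]]
  push_cast
  simp only [mul_ite, mul_one, mul_zero]
  split_ifs <;> ring

theorem min_sub_le {c p q v : ℝ} (hv : 0 ≤ v) :
    min c (min p q) - v ≤ min c (min (p - v) (q + v)) := by
  have h1 := min_le_left c (min p q)
  have h2 := min_le_right c (min p q)
  have h3 := min_le_left p q
  have h4 := min_le_right p q
  exact le_min (by linarith) (le_min (by linarith) (by linarith))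

theorem min_sub_le' {c p q v : ℝ} (hv : 0 ≤ v) :
    min c (min (p - v) (q + v)) - v ≤ min c (min p q) := by
  have h1 := min_le_left c (min (p - v) (q + v))
  have h2 := min_le_right c (min (p - v) (q + v))
  have h3 := min_le_left (p - v) (q + v)
  have h4 := min_le_right (p - v) (q + v)
  exact le_min (by linarith) (le_min (by linarith) (by linarith))

/-- Schedules with one on-period that respects the minimum-up time are feasible. -/
theorem onPoint_mem_P (hL : 1 ≤ D.L) (hell : 1 ≤ D.ell) (hClo : 0 ≤ D.Clo)
    (hCloV : D.Clo ≤ D.Vbar) (hVChi : D.Vbar ≤ D.Chi) (hV : 0 < D.V) {a b : ℤ}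
    (hab : a + D.L ≤ b + 1) : D.onPoint a b ∈ D.P := by
  have hx : ∀ j : ℤ, a ≤ j → j ≤ b →
      D.Clo ≤ min D.Chi (min (D.Vbar + (j - a : ℝ) * D.V) (D.Vbar + (b - j : ℝ) * D.V)) := by
    intro j ha hb
    have h1 : (0 : ℝ) ≤ (j - a : ℝ) * D.V :=
      mul_nonneg (sub_nonneg.2 (by exact_mod_cast ha)) hV.le
    have h2 : (0 : ℝ) ≤ (b - j : ℝ) * D.V :=
      mul_nonneg (sub_nonneg.2 (by exact_mod_cast hb)) hV.le
    exact le_min (hCloV.trans hVChi) (le_min (by linarith) (by linarith))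
  refine ⟨fun j hj => ?_, fun j hj => ?_, fun j hj => ?_, fun j hj => ?_, fun j hj => ?_,
    fun j hj => ?_, fun j hj => ?_, fun j hj => ?_, fun j hj => ?_, fun j hj => ?_⟩ <;>
    rw [Finset.mem_Icc] at hj
  · rw [onPoint_x hj.1 hj.2]
    split_ifs with h
    · exact hClo.trans (hx j h.1 h.2)
    · exact le_rfl
  · rw [onPoint_y hj.1 hj.2]
    split_ifs <;> simp
  · rw [onPoint_u hj.1 hj.2]
    split_ifs <;> simp
  · rw [onPoint_sum_u (by omega) hj.2, onPoint_y (by omega) hj.2]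
    split_ifs <;> first | omega | norm_num
  · rw [onPoint_sum_u (by omega) hj.2, onPoint_y (by omega) (by omega)]
    split_ifs <;> first | omega | norm_num
  · rw [onPoint_u hj.1 hj.2, onPoint_y (by omega) hj.2, onPoint_y (by omega) (by omega)]
    split_ifs <;> first | omega | norm_num
  · rw [onPoint_x hj.1 hj.2, onPoint_y hj.1 hj.2]
    split_ifs with h
    · linarith [hx j h.1 h.2]
    · simp
  · rw [onPoint_x hj.1 hj.2, onPoint_y hj.1 hj.2]
    split_ifs with h
    · linarith [min_le_left D.Chi (min (D.Vbar + (j - a : ℝ) * D.V) (D.Vbar + (b - j : ℝ) * D.V))]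
    · simp
  · rw [onPoint_x (by omega) hj.2, onPoint_x (by omega) (by omega),
      onPoint_y (by omega) (by omega)]
    split_ifs with h1 h2 h2
    · have h3 := min_sub_le (c := D.Chi) (p := D.Vbar + (j - a : ℝ) * D.V)
        (q := D.Vbar + (b - j : ℝ) * D.V) hV.le
      push_cast
      rw [show (j - 1 - a : ℝ) * D.V = (j - a : ℝ) * D.V - D.V by ring,
        show (b - (j - 1) : ℝ) * D.V = (b - j : ℝ) * D.V + D.V by ring, ← add_sub_assoc,
        ← add_assoc]
      linarith
    · have h3 : j = a := by omega
      have h4 := (min_le_right D.Chi (min (D.Vbar + (j - a : ℝ) * D.V)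
        (D.Vbar + (b - j : ℝ) * D.V))).trans (min_le_left _ _)
      rw [h3, sub_self, zero_mul, add_zero] at h4 ⊢
      linarith
    · have := hx _ h2.1 h2.2
      linarith
    · linarith
  · rw [onPoint_x (by omega) hj.2, onPoint_x (by omega) (by omega),
      onPoint_y (by omega) (by omega)]
    split_ifs with h2 h1 h1
    · have h3 := min_sub_le' (c := D.Chi) (p := D.Vbar + (j - a : ℝ) * D.V)
        (q := D.Vbar + (b - j : ℝ) * D.V) hV.le
      push_cast
      rw [show (j - 1 - a : ℝ) * D.V = (j - a : ℝ) * D.V - D.V by ring,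
        show (b - (j - 1) : ℝ) * D.V = (b - j : ℝ) * D.V + D.V by ring, ← add_sub_assoc,
        ← add_assoc]
      linarith
    · have h3 : j - 1 = b := by omega
      have h4 := (min_le_right D.Chi (min (D.Vbar + ((j - 1 : ℤ) - a : ℝ) * D.V)
        (D.Vbar + (b - (j - 1 : ℤ) : ℝ) * D.V))).trans (min_le_right _ _)
      rw [h3, sub_self, zero_mul, add_zero] at h4 ⊢
      linarith
    · have := hx _ h1.1 h1.2
      linarith
    · linarith

end MachineData

/-! ### Validity -/

/-- A period satisfying `q` is the right end of a maximal run of such periods. -/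
theorem exists_run_start {q : ℤ → Prop} {t : ℤ} (ht : 1 ≤ t) (hq : q t) :
    ∃ a, 1 ≤ a ∧ a ≤ t ∧ (∀ i, a ≤ i → i ≤ t → q i) ∧ (2 ≤ a → ¬ q (a - 1)) := by
  induction t, ht using Int.leInduction with
  | base => exact ⟨1, le_rfl, le_rfl, fun i h1 h2 => le_antisymm h1 h2 ▸ hq, by omega⟩
  | succ t ht ih =>
    by_cases h : q t
    · obtain ⟨a, h1, h2, h3, h4⟩ := ih h
      refine ⟨a, h1, by omega, fun i hi hit => ?_, h4⟩
      rcases hit.eq_or_lt with rfl | hit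
      · exact hq
      · exact h3 i hi (by omega)
    · exact ⟨t + 1, by omega, le_rfl, fun i h1 h2 => le_antisymm h1 h2 ▸ hq, fun _ => by simpa⟩

/-- A period satisfying `q` is the left end of a maximal run of such periods. -/
theorem exists_run_end {q : ℤ → Prop} {t T : ℤ} (ht : t ≤ T) (hq : q t) :
    ∃ b, t ≤ b ∧ b ≤ T ∧ (∀ i, t ≤ i → i ≤ b → q i) ∧ (b < T → ¬ q (b + 1)) := by
  obtain ⟨a, h1, h2, h3, h4⟩ := exists_run_start (q := fun i => q (T + 1 - i)) (t := T + 1 - t)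
    (by omega) (by simpa using hq)
  refine ⟨T + 1 - a, by omega, by omega, fun i hi hib => ?_, fun hb => ?_⟩
  · simpa using h3 (T + 1 - i) (by omega) (by omega)
  · simpa [show T + 1 - (a - 1) = T + 1 - a + 1 by ring] using h4 (by omega)

namespace MachineData

variable {D : MachineData} {p : Schedule D.T}

theorem u_nonneg (hp : p ∈ D.P) (i : ℤ) : 0 ≤ p.u i := by
  obtain ⟨-, -, hu, -⟩ := hp
  by_cases hi : i ∈ Finset.Icc 2 D.T
  · rcases hu i hi with h | h <;> rw [h]
    exact zero_le_one
  · simp only [Schedule.u, coordAt, dif_neg hi, le_refl]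

theorem y_le_add_sum_u (hp : p ∈ D.P) {c d : ℤ} (hc : 1 ≤ c) (hcd : c ≤ d) (hd : d ≤ D.T) :
    p.y d ≤ p.y c + ∑ i ∈ Finset.Icc (c + 1) d, p.u i := by
  induction d, hcd using Int.leInduction with
  | base => simp
  | succ d hcd ih =>
    obtain ⟨-, -, -, -, -, hstart, -⟩ := hp
    have h1 := hstart (d + 1) (Finset.mem_Icc.2 ⟨by omega, hd⟩)
    have h2 : Finset.Icc (c + 1) (d + 1) = insert (d + 1) (Finset.Icc (c + 1) d) := by
      ext; simp only [Finset.mem_insert, Finset.mem_Icc]; omega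
    rw [h2, Finset.sum_insert (by simp)]
    rw [add_sub_cancel_right] at h1
    linarith [ih (by omega)]

/-- A running machine is not started up. When the minimum-down window of `j` extends beyond the
horizon, a start-up in period `j` and the one that precedes `j - 1` would share the last
minimum-down window. -/
theorem u_eq_zero_of_on (hp : p ∈ D.P) (hell : 1 ≤ D.ell) (hellT : D.ell + 1 ≤ D.T) {j : ℤ}
    (hj : 2 ≤ j) (hjT : j ≤ D.T) (hy : p.y (j - 1) = 1) : p.u j = 0 := by
  refine le_antisymm ?_ (u_nonneg hp j)
  have hsum := y_le_add_sum_u hp (c := min D.T (j - 1 + D.ell) - D.ell) (d := j - 1)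
    (by omega) (by omega) (by omega)
  have hnn := u_nonneg hp
  obtain ⟨-, -, -, -, hdown, -⟩ := hp
  have h1 := hdown (min D.T (j - 1 + D.ell)) (Finset.mem_Icc.2 ⟨by omega, by omega⟩)
  have h2 : insert j (Finset.Icc (min D.T (j - 1 + D.ell) - D.ell + 1) (j - 1)) ⊆
      Finset.Icc (min D.T (j - 1 + D.ell) - D.ell + 1) (min D.T (j - 1 + D.ell)) := by
    intro i; simp only [Finset.mem_insert, Finset.mem_Icc]; omega
  have h3 := Finset.sum_le_sum_of_subset_of_nonneg h2 fun i _ _ => hnn i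
  rw [Finset.sum_insert (by simp)] at h3
  linarith

theorem w_nonneg (hp : p ∈ D.P) {i : ℤ} (hi : D.L + 1 ≤ i) (hT : i ≤ D.T) : 0 ≤ D.w p i := by
  obtain ⟨-, -, -, hup, -⟩ := hp
  rw [w, sum_Icc_u_sub]
  linarith [hup i (Finset.mem_Icc.2 ⟨hi, hT⟩)]

theorem w_eq_one (hp : p ∈ D.P) (hL : 1 ≤ D.L) (hell : 1 ≤ D.ell) (hellT : D.ell + 1 ≤ D.T)
    {i : ℤ} (hi : D.L + 1 ≤ i) (hT : i ≤ D.T) (hon : ∀ j, i - D.L ≤ j → j ≤ i → p.y j = 1) :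
    D.w p i = 1 := by
  rw [w, sum_Icc_u_sub, hon i (by omega) le_rfl, Finset.sum_eq_zero, sub_zero]
  intro j hj
  rw [Finset.mem_Icc] at hj
  exact u_eq_zero_of_on hp hell hellT (by omega) (by omega) (hon _ (by omega) (by omega))

theorem x_eq_zero (hp : p ∈ D.P) {i : ℤ} (h1 : 1 ≤ i) (hT : i ≤ D.T) (hy : p.y i = 0) :
    p.x i = 0 := by
  obtain ⟨hx, -, -, -, -, -, -, hhi, -⟩ := hp
  have h2 := hx i (Finset.mem_Icc.2 ⟨h1, hT⟩)
  have h3 := hhi i (Finset.mem_Icc.2 ⟨h1, hT⟩)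
  rw [hy] at h3
  linarith

theorem x_le_of_start (hp : p ∈ D.P) {a t : ℤ} (ha : 2 ≤ a) (hat : a ≤ t) (hT : t ≤ D.T)
    (hoff : p.y (a - 1) = 0) (hon : ∀ i, a ≤ i → i ≤ t → p.y i = 1) :
    p.x t ≤ D.Vbar + (t - a : ℝ) * D.V := by
  have hx0 := x_eq_zero hp (i := a - 1) (by omega) (by omega) hoff
  obtain ⟨-, -, -, -, -, -, -, -, hru, -⟩ := hp
  induction t, hat using Int.leInduction with
  | base =>
    have := hru a (Finset.mem_Icc.2 ⟨ha, hT⟩)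
    rw [hoff, hx0] at this
    linarith
  | succ t hat ih =>
    have h1 := hru (t + 1) (Finset.mem_Icc.2 ⟨by omega, hT⟩)
    rw [add_sub_cancel_right, hon t hat (by omega)] at h1
    have h2 := ih (by omega) fun i h h' => hon i h (by omega)
    push_cast
    linarith

theorem x_le_of_end (hp : p ∈ D.P) {b t : ℤ} (ht : 1 ≤ t) (htb : t ≤ b) (hT : b < D.T)
    (hoff : p.y (b + 1) = 0) (hon : ∀ i, t ≤ i → i ≤ b → p.y i = 1) :
    p.x t ≤ D.Vbar + (b - t : ℝ) * D.V := by
  have hx0 := x_eq_zero hp (i := b + 1) (by omega) (by omega) hoff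
  obtain ⟨-, -, -, -, -, -, -, -, -, hrd⟩ := hp
  -- downward induction from `b`
  have key : ∀ s, 0 ≤ s → t ≤ b - s → p.x (b - s) ≤ D.Vbar + s * D.V := by
    intro s hs
    induction s, hs using Int.leInduction with
    | base =>
      intro _
      have := hrd (b + 1) (Finset.mem_Icc.2 ⟨by omega, by omega⟩)
      rw [hoff, hx0, add_sub_cancel_right] at this
      simpa using this
    | succ s hs ih =>
      intro hts
      have h1 := hrd (b - s) (Finset.mem_Icc.2 ⟨by omega, by omega⟩)
      rw [hon (b - s) (by omega) (by omega)] at h1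
      have h2 := ih (by omega)
      rw [show b - (s + 1) = b - s - 1 by ring]
      push_cast
      linarith
  simpa using key (b - t) (by omega) (by omega)

/-- The minimum-up time restricts the length of an on-period. -/
theorem le_of_run (hp : p ∈ D.P) {a b : ℤ} (ha : 2 ≤ a) (hab : a ≤ b) (hLb : D.L ≤ b)
    (hT : b < D.T) (hoff : p.y (a - 1) = 0) (hon : p.y a = 1) (hoff' : p.y (b + 1) = 0) :
    a + D.L ≤ b + 1 := by
  by_contra hlt
  have hnn := u_nonneg hp
  obtain ⟨-, -, -, hup, -, hstart, -⟩ := hp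
  have h1 := hup (b + 1) (Finset.mem_Icc.2 ⟨by omega, by omega⟩)
  have h2 := hstart a (Finset.mem_Icc.2 ⟨ha, by omega⟩)
  have h3 := Finset.single_le_sum (fun i _ => hnn i)
    (Finset.mem_Icc.2 ⟨by omega, by omega⟩ : a ∈ Finset.Icc (b + 1 - D.L + 1) (b + 1))
  rw [hoff'] at h1
  rw [hon, hoff] at h2
  linarith

theorem phi_ge (hp : p ∈ D.P) {t : ℤ} (htT : t ≤ D.T) (hV : 0 < D.V) {a : ℤ}
    (ha : D.L ≤ t - a ∨ 1 ≤ p.u a) :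
    D.V * (D.phiCoeff t (t - a) : ℝ) ≤ D.phi p t := by
  rw [phi_eq _ htT]
  refine mul_le_mul_of_nonneg_left ?_ hV.le
  have hnn : ∀ k ∈ Finset.Icc 0 (D.L - 1), 0 ≤ (D.phiCoeff t k : ℝ) * p.u (t - k) := fun k _ =>
    mul_nonneg (by exact_mod_cast phiCoeff_nonneg D t k) (u_nonneg hp _)
  by_cases hk : t - a ∈ Finset.Icc 0 (D.L - 1)
  · refine le_trans ?_ (Finset.single_le_sum hnn hk)
    rw [sub_sub_cancel]
    refine le_mul_of_one_le_right (by exact_mod_cast phiCoeff_nonneg D t _) ?_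
    rw [Finset.mem_Icc] at hk
    exact ha.resolve_left (by omega)
  · rw [Finset.mem_Icc] at hk
    rw [phiCoeff_eq_zero htT (by omega), Int.cast_zero]
    exact Finset.sum_nonneg hnn

namespace IsAdmissible

variable {t m n : ℤ} {S : Finset ℤ}

/-- The bound of a feasible schedule that is on in `[a, b]` is at least that of the schedule that
is on in `[a, b]` only. -/
theorem le_upperBound (h : D.IsAdmissible t m n S) (hp : p ∈ D.P) {a b : ℤ}
    (hon : ∀ i, a ≤ i → i ≤ b → p.y i = 1)
    (ha : D.L ≤ t - a ∨ 1 ≤ p.u a) :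
    D.Vbar * p.y t + D.V * D.rise t m n S a b +
      D.beta m * (if a + D.L ≤ t - m ∧ t - m ≤ b then 1 else 0) ≤ D.upperBound t m n S p := by
  have hL := h.one_le_L
  have hn := h.n_nonneg
  have hLm := h.L_lt_sub
  have hm := h.m_nonneg
  have htT := h.t_le_T
  have hw : ∀ i, D.L + 1 ≤ i → i ≤ D.T →
      (if a + D.L ≤ i ∧ i ≤ b then (1 : ℝ) else 0) ≤ D.w p i := by
    intro i hi hiT
    split_ifs with hab
    · exact (w_eq_one hp hL h.one_le_ell h.ell_lt_T hi hiT
        fun j h1 h2 => hon j (by omega) (by omega)).ge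
    · exact w_nonneg hp hi hiT
  have h1 : ∑ i ∈ S, ((i - predIn S t m i : ℤ) : ℝ) *
      (if a + D.L ≤ i ∧ i ≤ b then (1 : ℝ) else 0) ≤
      ∑ i ∈ S, ((i - predIn S t m i : ℤ) : ℝ) * D.w p i := by
    refine Finset.sum_le_sum fun i hi => ?_
    have h1 := h.lt_of_mem i hi
    have h2 := h.le_of_mem i hi
    refine mul_le_mul_of_nonneg_left (hw i (by omega) (by omega)) ?_
    have := predIn_lt (S := S) h1
    exact_mod_cast (by omega : 0 ≤ i - predIn S t m i)
  have h2 : ∑ k ∈ Finset.Icc 1 (max (n - 1) 0),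
      (if a + D.L ≤ t + k ∧ t + k ≤ b then (1 : ℝ) else 0) ≤
      ∑ k ∈ Finset.Icc 1 (max (n - 1) 0), D.w p (t + k) := by
    refine Finset.sum_le_sum fun k hk => ?_
    have := Finset.mem_Icc.1 hk
    have := h.n_le_T
    exact hw _ (by omega) (by omega)
  have h3 := mul_le_mul_of_nonneg_left (hw (t + n) (by omega) h.n_le_T)
    (by exact_mod_cast h.alpha_nonneg : (0 : ℝ) ≤ D.alpha t m n S)
  have h4 := mul_le_mul_of_nonneg_left (hw (t - m) hLm (by omega)) h.beta_nonneg
  have h5 := phi_ge hp htT h.V_pos ha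
  have h6 : (D.rise t m n S a b : ℝ) =
      ∑ i ∈ S, ((i - predIn S t m i : ℤ) : ℝ) *
        (if a + D.L ≤ i ∧ i ≤ b then (1 : ℝ) else 0) +
      ∑ k ∈ Finset.Icc 1 (max (n - 1) 0),
        (if a + D.L ≤ t + k ∧ t + k ≤ b then (1 : ℝ) else 0) +
      D.alpha t m n S * (if a + D.L ≤ t + n ∧ t + n ≤ b then (1 : ℝ) else 0) +
      D.phiCoeff t (t - a) := by
    rw [rise]
    push_cast
    simp only [mul_ite, mul_one, mul_zero]
  have h7 := mul_le_mul_of_nonneg_left (add_le_add (add_le_add h1 h2) h3) h.V_pos.le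
  rw [h6, upperBound]
  linarith

theorem x_le_upperBound (h : D.IsAdmissible t m n S) (hp : p ∈ D.P) :
    p.x t ≤ D.upperBound t m n S p := by
  have hLt := h.L_lt_t
  have hL := h.one_le_L
  have htT := h.t_le_T
  have hm := h.m_nonneg
  have hV := h.V_pos
  have hβ := h.beta_nonneg
  have ht : t ∈ Finset.Icc 1 D.T := Finset.mem_Icc.2 ⟨by omega, htT⟩
  have hbin := hp.2.1
  rcases hbin t ht with hy | hy
  · -- the empty on-period `[1, 0]`
    rw [x_eq_zero hp (by omega) htT hy]
    have h1 := h.le_upperBound hp (a := 1) (b := 0) (fun i _ _ => by omega)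
      (Or.inl (by omega))
    rw [h.rise_eq_zero_of_lt (by omega) (by omega) (fun i hi => by
      have := h.lt_of_mem i hi; omega), hy, if_neg (by omega)] at h1
    simpa using h1
  obtain ⟨a, ha1, hat, hona, hoffa⟩ := exists_run_start (q := fun i => p.y i = 1)
    (by omega : 1 ≤ t) hy
  obtain ⟨b, htb, hbT, honb, hoffb⟩ := exists_run_end (q := fun i => p.y i = 1) htT hy
  have hon : ∀ i, a ≤ i → i ≤ b → p.y i = 1 := fun i h1 h2 => by
    rcases le_total i t with h3 | h3
    · exact hona i h1 h3
    · exact honb i h3 h2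
  have hoffa' : 2 ≤ a → p.y (a - 1) = 0 := fun ha =>
    (hbin _ (Finset.mem_Icc.2 ⟨by omega, by omega⟩)).resolve_right (hoffa ha)
  have hoffb' : b < D.T → p.y (b + 1) = 0 := fun hb =>
    (hbin _ (Finset.mem_Icc.2 ⟨by omega, by omega⟩)).resolve_right (hoffb hb)
  have ha : D.L ≤ t - a ∨ 1 ≤ p.u a := by
    by_cases ha : 2 ≤ a
    · have := hp.2.2.2.2.2.1 a (Finset.mem_Icc.2 ⟨ha, by omega⟩)
      rw [hoffa' ha, hon a le_rfl (by omega)] at this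
      exact Or.inr (by linarith)
    · exact Or.inl (by omega)
  have h1 := h.le_upperBound hp hon ha
  rw [hy, mul_one] at h1
  have hind : 0 ≤ D.beta m * (if a + D.L ≤ t - m ∧ t - m ≤ b then (1 : ℝ) else 0) :=
    mul_nonneg hβ (by split_ifs <;> norm_num)
  rcases h.rise_ge hat htb hbT fun ha hb => le_of_run hp ha (by omega) (by omega) hb (hoffa' ha)
    (hon a le_rfl (by omega)) (hoffb' hb) with ⟨h2, h3⟩ | ⟨h2, h3⟩ | ⟨h2, h3⟩
  · have h4 := x_le_of_start hp h2 hat htT (hoffa' h2) hona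
    have h5 : (t - a : ℝ) ≤ D.rise t m n S a b := by exact_mod_cast h3
    nlinarith [mul_le_mul_of_nonneg_left h5 hV.le]
  · have h4 := x_le_of_end hp (by omega) htb h2 (hoffb' h2) honb
    have h5 : (b - t : ℝ) ≤ D.rise t m n S a b := by exact_mod_cast h3
    nlinarith [mul_le_mul_of_nonneg_left h5 hV.le]
  · have h4 := hp.2.2.2.2.2.2.2.1 t ht
    have h5 : ((m + D.L - 1 : ℤ) : ℝ) ≤ D.rise t m n S a b := by exact_mod_cast h3
    rw [if_pos ⟨h2, by omega⟩, beta] at h1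
    rw [hy] at h4
    linarith [mul_le_mul_of_nonneg_left h5 hV.le]

end IsAdmissible
end MachineData

/-! ### Tight schedules and the functionals vanishing on them -/

theorem coordAt_add {I : Finset ℤ} (f g : I → ℝ) (i : ℤ) :
    coordAt (f + g) i = coordAt f i + coordAt g i := by
  unfold coordAt; split_ifs <;> simp

theorem coordAt_smul {I : Finset ℤ} (c : ℝ) (f : I → ℝ) (i : ℤ) :
    coordAt (c • f) i = c * coordAt f i := by
  unfold coordAt; split_ifs <;> simp

theorem coordAt_of_notMem {I : Finset ℤ} (f : I → ℝ) {i : ℤ} (hi : i ∉ I) : coordAt f i = 0 :=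
  dif_neg hi

/-- A linear functional on `ℝ^I` is the scalar product with its coefficient vector. -/
theorem linearMap_eq_sum_coordAt {I : Finset ℤ} (g : (I → ℝ) →ₗ[ℝ] ℝ) (f : I → ℝ) :
    g f = ∑ i ∈ I, coordAt (fun j => g (Pi.single j 1)) i * coordAt f i := by
  rw [g.pi_apply_eq_sum_univ f, ← Finset.sum_coe_sort I]
  refine Finset.sum_congr rfl fun i _ => ?_
  rw [coordAt, dif_pos i.2, coordAt, dif_pos i.2, smul_eq_mul, mul_comm]
  congr 2
  ext j
  simp [Pi.single_apply, eq_comm]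

namespace Schedule

variable {T : ℤ}

theorem x_add (p q : Schedule T) (i : ℤ) : (p + q).x i = p.x i + q.x i := coordAt_add _ _ _
theorem y_add (p q : Schedule T) (i : ℤ) : (p + q).y i = p.y i + q.y i := coordAt_add _ _ _
theorem u_add (p q : Schedule T) (i : ℤ) : (p + q).u i = p.u i + q.u i := coordAt_add _ _ _
theorem x_smul (c : ℝ) (p : Schedule T) (i : ℤ) : (c • p).x i = c * p.x i := coordAt_smul _ _ _
theorem y_smul (c : ℝ) (p : Schedule T) (i : ℤ) : (c • p).y i = c * p.y i := coordAt_smul _ _ _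
theorem u_smul (c : ℝ) (p : Schedule T) (i : ℤ) : (c • p).u i = c * p.u i := coordAt_smul _ _ _

/-- Every linear functional on schedules is given by coefficients for `x`, `y` and `u`. -/
theorem exists_coeff (g : Schedule T →ₗ[ℝ] ℝ) : ∃ A B C : ℤ → ℝ,
    (∀ i ∉ Finset.Icc 2 T, C i = 0) ∧ ∀ p : Schedule T, g p =
      ∑ i ∈ Finset.Icc 1 T, A i * p.x i + ∑ i ∈ Finset.Icc 1 T, B i * p.y i +
        ∑ i ∈ Finset.Icc 2 T, C i * p.u i := by
  refine ⟨coordAt fun j => (g ∘ₗ LinearMap.inl ℝ _ _) (Pi.single j 1),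
    coordAt fun j => (g ∘ₗ LinearMap.inr ℝ _ _ ∘ₗ LinearMap.inl ℝ _ _) (Pi.single j 1),
    coordAt fun j => (g ∘ₗ LinearMap.inr ℝ _ _ ∘ₗ LinearMap.inr ℝ _ _) (Pi.single j 1),
    fun i hi => coordAt_of_notMem _ hi, fun p => ?_⟩
  simp only [Schedule.x, Schedule.y, Schedule.u]
  rw [← linearMap_eq_sum_coordAt, ← linearMap_eq_sum_coordAt, ← linearMap_eq_sum_coordAt]
  simp only [LinearMap.comp_apply, ← map_add]
  congr 1
  ext <;> simp

end Schedule

namespace MachineData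

variable {D : MachineData}

theorem w_add (p q : Schedule D.T) (i : ℤ) : D.w (p + q) i = D.w p i + D.w q i := by
  simp only [w, Schedule.y_add, Schedule.u_add, Finset.sum_add_distrib]
  ring

theorem w_smul (c : ℝ) (p : Schedule D.T) (i : ℤ) : D.w (c • p) i = c * D.w p i := by
  simp only [w, Schedule.y_smul, Schedule.u_smul, ← Finset.mul_sum]
  ring

variable (D) in
/-- The difference of the two sides of the inequality, as a linear functional. -/
noncomputable def slack (t m n : ℤ) (S : Finset ℤ) : Schedule D.T →ₗ[ℝ] ℝ where
  toFun p := D.upperBound t m n S p - p.x t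
  map_add' p q := by
    simp only [upperBound, phi, w_add, Schedule.x_add, Schedule.y_add, Schedule.u_add, mul_add,
      Finset.sum_add_distrib]
    ring
  map_smul' c p := by
    simp only [upperBound, phi, w_smul, Schedule.x_smul, Schedule.y_smul, Schedule.u_smul,
      mul_left_comm _ c, ← Finset.mul_sum, RingHom.id_apply, smul_eq_mul]
    ring

theorem slack_apply (t m n : ℤ) (S : Finset ℤ) (p : Schedule D.T) :
    D.slack t m n S p = D.upperBound t m n S p - p.x t := rfl

/-- The schedule that is on throughout, with the generation amounts `x`. -/
def allOn (D : MachineData) (x : ℤ → ℝ) : Schedule D.T :=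
  (fun j => x j, fun _ => 1, fun _ => 0)

theorem allOn_x (x : ℤ → ℝ) {j : ℤ} (h1 : 1 ≤ j) (hT : j ≤ D.T) : (D.allOn x).x j = x j := by
  simp [Schedule.x, coordAt, allOn, h1, hT]

theorem allOn_y (x : ℤ → ℝ) {j : ℤ} (h1 : 1 ≤ j) (hT : j ≤ D.T) : (D.allOn x).y j = 1 := by
  simp [Schedule.y, coordAt, allOn, h1, hT]

theorem allOn_u (x : ℤ → ℝ) (j : ℤ) : (D.allOn x).u j = 0 := by
  simp [Schedule.u, coordAt, allOn]

theorem allOn_mem_P (hell : 1 ≤ D.ell) (hClo : 0 ≤ D.Clo) {x : ℤ → ℝ}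
    (hlo : ∀ j, D.Clo ≤ x j) (hhi : ∀ j, x j ≤ D.Chi) (hup : ∀ j, x j - x (j - 1) ≤ D.V)
    (hdn : ∀ j, x (j - 1) - x j ≤ D.V) (hL : 1 ≤ D.L) : D.allOn x ∈ D.P := by
  refine ⟨fun j hj => ?_, fun j hj => ?_, fun j hj => ?_, fun j hj => ?_, fun j hj => ?_,
    fun j hj => ?_, fun j hj => ?_, fun j hj => ?_, fun j hj => ?_, fun j hj => ?_⟩ <;>
    rw [Finset.mem_Icc] at hj
  · rw [allOn_x x hj.1 hj.2]; exact hClo.trans (hlo j)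
  · exact Or.inr (allOn_y x hj.1 hj.2)
  · exact Or.inl (allOn_u x j)
  · rw [Finset.sum_eq_zero fun i _ => allOn_u x i, allOn_y x (by omega) hj.2]
    exact zero_le_one
  · rw [Finset.sum_eq_zero fun i _ => allOn_u x i, allOn_y x (by omega) (by omega), sub_self]
  · rw [allOn_u, allOn_y x (by omega) hj.2, allOn_y x (by omega) (by omega)]; norm_num
  · rw [allOn_x x hj.1 hj.2, allOn_y x hj.1 hj.2]; linarith [hlo j]
  · rw [allOn_x x hj.1 hj.2, allOn_y x hj.1 hj.2]; linarith [hhi j]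
  · rw [allOn_x x (by omega) hj.2, allOn_x x (by omega) (by omega),
      allOn_y x (by omega) (by omega)]
    linarith [hup j]
  · rw [allOn_x x (by omega) hj.2, allOn_x x (by omega) (by omega), allOn_y x (by omega) hj.2]
    linarith [hdn j]

theorem zero_mem_P (hCloV : D.Clo ≤ D.Vbar) (hClo : 0 ≤ D.Clo) : (0 : Schedule D.T) ∈ D.P := by
  have hx : ∀ i, (0 : Schedule D.T).x i = 0 := fun i => by simp [Schedule.x, coordAt]
  have hy : ∀ i, (0 : Schedule D.T).y i = 0 := fun i => by simp [Schedule.y, coordAt]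
  have hu : ∀ i, (0 : Schedule D.T).u i = 0 := fun i => by simp [Schedule.u, coordAt]
  have hVbar := hClo.trans hCloV
  simpa [P, hx, hy, hu] using fun _ _ _ => hVbar

namespace IsAdmissible

variable {t m n : ℤ} {S : Finset ℤ}

theorem upperBound_allOn (h : D.IsAdmissible t m n S) (x : ℤ → ℝ) :
    D.upperBound t m n S (D.allOn x) = D.Chi := by
  have hL := h.one_le_L
  have hn := h.n_nonneg
  have hnT := h.n_le_T
  have hLt := h.L_lt_t
  have hm := h.m_nonneg
  have htT := h.t_le_T
  have hLm := h.L_lt_sub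
  have hw : ∀ i, 1 ≤ i → i ≤ D.T → D.w (D.allOn x) i = 1 := fun i h1 hT => by
    rw [w, Finset.sum_eq_zero fun _ _ => allOn_u x _, allOn_y x h1 hT, sub_zero]
  have h1 := sum_gap_lt h.lt_of_mem (t + 1)
  rw [Finset.filter_true_of_mem fun i hi => by have := h.le_of_mem i hi; omega] at h1
  have h2 := h.alpha_eq
  have h3 : (∑ i ∈ S, (i - predIn S t m i) : ℤ) + max (n - 1) 0 + D.alpha t m n S =
    m + D.L - 1 := by omega
  have h4 : ((∑ i ∈ S, (i - predIn S t m i) : ℤ) : ℝ) + ((max (n - 1) 0 : ℤ) : ℝ) +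
    (D.alpha t m n S : ℝ) = ((m + D.L - 1 : ℤ) : ℝ) := by exact_mod_cast h3
  rw [upperBound, phi_eq _ htT, allOn_y x (by omega) htT, hw (t + n) (by omega) hnT,
    hw (t - m) (by omega) (by omega),
    Finset.sum_eq_zero (s := Finset.Icc 0 (D.L - 1)) fun k _ => by rw [allOn_u, mul_zero],
    Finset.sum_congr rfl fun i hi => by
      rw [hw i (by have := h.lt_of_mem i hi; omega) (by have := h.le_of_mem i hi; omega)],
    Finset.sum_congr (s₁ := Finset.Icc 1 _) rfl fun k hk => by
      have := Finset.mem_Icc.1 hk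
      rw [hw (t + k) (by omega) (by omega)]]
  have h5 : ∑ k ∈ Finset.Icc 1 (max (n - 1) 0), (1 : ℝ) = ((max (n - 1) 0 : ℤ) : ℝ) := by
    rw [Finset.sum_const, Int.card_Icc, nsmul_eq_mul, mul_one, add_sub_cancel_right,
      ← Int.cast_natCast, Int.toNat_of_nonneg (by omega)]
  simp only [mul_one]
  rw [h5, ← Int.cast_sum, beta, ← h4]
  ring

/-- An on-period containing `t` is tight when the ramping limits at its ends are attained by
`rise`. -/
theorem slack_onPoint_of_mem (h : D.IsAdmissible t m n S) {a b : ℤ} (hab : a + D.L ≤ b + 1)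
    (hat : a ≤ t) (htb : t ≤ b) (hm : t - m < a + D.L)
    (hr : D.rise t m n S a b = min (t - a) (b - t)) : D.slack t m n S (D.onPoint a b) = 0 := by
  have hLt := h.L_lt_t
  have hV := h.V_pos
  have hβ := h.beta_nonneg
  rw [slack_apply, h.upperBound_onPoint hab, onPoint_x (by have := h.one_le_L; omega) h.t_le_T,
    if_pos (show a ≤ t ∧ t ≤ b from ⟨hat, htb⟩), if_pos (show a ≤ t ∧ t ≤ b from ⟨hat, htb⟩),
    if_neg (by omega), hr, min_add_add_left,
    ← min_mul_of_nonneg _ _ hV.le]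
  push_cast
  have h1 : min (t - a : ℝ) (b - t) ≤ ((m + D.L - 1 : ℤ) : ℝ) :=
    (min_le_left _ _).trans (by exact_mod_cast (by omega : t - a ≤ m + D.L - 1))
  have h2 := mul_le_mul_of_nonneg_right h1 hV.le
  rw [beta] at hβ
  rw [min_eq_right (a := D.Chi) (by linarith)]
  ring

/-- An on-period that ends before `t` is tight if it avoids `S ∪ {t - m}` once its minimum-up time
is over. -/
theorem slack_onPoint_of_lt (h : D.IsAdmissible t m n S) {a b : ℤ} (hab : a + D.L ≤ b + 1)
    (hbt : b < t) (hS : ∀ i ∈ S, ¬ (a + D.L ≤ i ∧ i ≤ b))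
    (hm : ¬ (a + D.L ≤ t - m ∧ t - m ≤ b)) : D.slack t m n S (D.onPoint a b) = 0 := by
  have hLt := h.L_lt_t
  rw [slack_apply, h.upperBound_onPoint hab, onPoint_x (by have := h.one_le_L; omega) h.t_le_T,
    h.rise_eq_zero_of_lt hbt (by omega) hS, if_neg (by omega), if_neg (by omega), if_neg (by omega)]
  simp

/-- An on-period that starts after `t` is tight. -/
theorem slack_onPoint_of_gt (h : D.IsAdmissible t m n S) {a b : ℤ} (hab : a + D.L ≤ b + 1)
    (hta : t < a) : D.slack t m n S (D.onPoint a b) = 0 := by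
  have hLt := h.L_lt_t
  have hL := h.one_le_L
  have hnL := h.n_le_L
  have hm := h.m_nonneg
  have hr : D.rise t m n S a b = 0 := by
    rw [rise, Finset.sum_eq_zero fun i hi => if_neg (by have := h.le_of_mem i hi; omega),
      Finset.sum_eq_zero fun k hk => ?_, if_neg (by omega),
      phiCoeff_eq_zero h.t_le_T (by omega)]
    · rfl
    · have := Finset.mem_Icc.1 hk
      exact if_neg (by omega)
  rw [slack_apply, h.upperBound_onPoint hab, onPoint_x (by omega) h.t_le_T, hr,
    if_neg (by omega), if_neg (by omega), if_neg (by omega)]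
  simp

/-- The conditions imposed by the tight on-periods on the prefix sums `F` of the coefficients of
`y` and the coefficients `C` of `u` in a linear functional force these to vanish. -/
theorem eq_zero_of_tight (h : D.IsAdmissible t m n S) {F C : ℤ → ℝ}
    (hF0 : ∀ j ≤ 0, F j = 0) (hFT : ∀ j, D.T ≤ j → F j = 0)
    (H : ∀ a b, a + D.L ≤ b + 1 → D.slack t m n S (D.onPoint a b) = 0 →
      F b - F (a - 1) + C a = 0) :
    (∀ j, F j = 0) ∧ ∀ a, C a = 0 := by
  have hL := h.one_le_L
  have hLt := h.L_lt_t
  have htT := h.t_le_T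
  have hm := h.m_nonneg
  have hn := h.n_nonneg
  have hnT := h.n_le_T
  have hnL := h.n_le_L
  -- on-periods of length `L` that end before `t`
  have hshort : ∀ a, a + D.L ≤ t → F (a + D.L - 1) - F (a - 1) + C a = 0 := fun a ha =>
    H a _ (by omega) (h.slack_onPoint_of_lt (by omega) (by omega) (fun i _ => by omega)
      (by omega))
  -- lengthening such an on-period by one period outside `S ∪ {t - m}`
  have hstep : ∀ i < t, i ∉ S → i ≠ t - m → F i = F (i - 1) := fun i hi hiS him => by
    have h1 := hshort (i - D.L) (by omega)
    have h2 := H (i - D.L) i (by omega) (h.slack_onPoint_of_lt (by omega) hi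
      (fun j hj hij => hiS ((by omega : j = i) ▸ hj)) (by omega))
    rw [sub_add_cancel] at h1
    linarith
  -- on-periods without shut-down that leave their minimum-up time right after an element of
  -- `S ∪ {t - m}`
  have hlong : ∀ i, i ∈ S ∨ i = t - m → (i < t ∨ i = t ∧ 1 ≤ n) →
      C (i - D.L + 1) = F (i - D.L) := fun i hi hit => by
    have him : t - m ≤ i := hi.elim (fun h' => (h.lt_of_mem i h').le) fun h' => h'.ge
    have h1 := H (i - D.L + 1) (D.T + t + D.L + m) (by omega) (h.slack_onPoint_of_mem (by omega)
      (by omega) (by omega) (by omega) (by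
        rw [h.rise_eq_of_mem hi hit (by omega)]; omega))
    rw [hFT _ (by omega), add_sub_cancel_right] at h1
    linarith
  have hbelow : ∀ i < t, F i = 0 := by
    intro i hi
    rcases le_total i 0 with hi0 | hi0
    · exact hF0 i hi0
    · induction i, hi0 using Int.leInduction with
      | base => exact hF0 0 le_rfl
      | succ i hi0 ih =>
        by_cases hiS : i + 1 ∈ S ∨ i + 1 = t - m
        · have h1 := hlong (i + 1) hiS (Or.inl hi)
          have h2 := hshort (i + 1 - D.L + 1) (by omega)
          rw [add_sub_cancel_right, show i + 1 - D.L + 1 + D.L - 1 = i + 1 by ring] at h2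
          linarith
        · rw [not_or] at hiS
          rw [hstep (i + 1) hi hiS.1 hiS.2, add_sub_cancel_right]
          exact ih (by omega)
  have hC : ∀ a, a + D.L ≤ t → C a = 0 := fun a ha => by
    have := hshort a ha
    rw [hbelow _ (by omega), hbelow _ (by omega)] at this
    linarith
  have habove : ∀ j, t + n ≤ j → F j = 0 := by
    intro j hj
    by_cases hnT' : t + n + 1 ≤ D.T
    · have key : ∀ b, t + n ≤ b → t ≤ b → F b + C (t + n + 1 - D.L) = 0 := fun b hb htb => by
        have h1 := h.n_half hnT'
        have h2 := H (t + n + 1 - D.L) b (by omega) (h.slack_onPoint_of_mem (by omega) (by omega)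
          htb (by omega) (by rw [h.rise_eq_of_up_end hnT' hb]; omega))
        rw [hbelow (t + n + 1 - D.L - 1) (by omega)] at h2
        linarith
      have h1 := key j hj (by omega)
      have h2 := key (max j D.T) (by omega) (by omega)
      rw [hFT _ (le_max_right _ _)] at h2
      linarith
    · exact hFT j (by omega)
  have hF : ∀ j, F j = 0 := by
    intro j
    rcases lt_or_ge j t with hj | hj
    · exact hbelow j hj
    rcases le_or_gt (t + n) j with hj' | hj'
    · exact habove j hj'
    -- here `n ≥ 1`, and all on-periods `[t - L + 1, t + r]` with `0 ≤ r < n` are tight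
    have hr : ∀ r, 0 ≤ r → r < n → F (t + r) + C (t - D.L + 1) = 0 := fun r hr0 hrn => by
      have h1 := H (t - D.L + 1) (t + r) (by omega) (h.slack_onPoint_of_mem (by omega) (by omega)
        (by omega) (by omega) (by rw [h.rise_eq_of_shutdown hr0 hrn]; omega))
      rw [hbelow (t - D.L + 1 - 1) (by omega)] at h1
      linarith
    have hCt : C (t - D.L + 1) = 0 := by
      by_cases htS : t ∈ S ∨ t = t - m
      · rw [hlong t htS (Or.inr ⟨rfl, by omega⟩)]
        exact hbelow _ (by omega)
      · rw [not_or] at htS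
        have h1 := H (t - D.L) t (by omega) (h.slack_onPoint_of_mem (by omega) (by omega)
          le_rfl (by omega) (by rw [h.rise_eq_of_notMem htS.1 (by omega)]; omega))
        rw [hbelow (t - D.L - 1) (by omega), hC _ (by omega)] at h1
        have h2 := hr 0 le_rfl (by omega)
        rw [add_zero] at h2
        linarith
    have h1 := hr (j - t) (by omega) (by omega)
    rw [hCt, add_sub_cancel] at h1
    linarith
  refine ⟨hF, fun a => ?_⟩
  have key : ∀ b, a + D.L ≤ b + 1 → D.slack t m n S (D.onPoint a b) = 0 → C a = 0 :=
    fun b hab hs => by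
      have := H a b hab hs
      rw [hF, hF] at this
      linarith
  rcases le_or_gt (a + D.L) t with ha | ha
  · exact hC a ha
  rcases lt_or_ge t a with hta | hta
  · exact key (a + D.L) (by omega) (h.slack_onPoint_of_gt (by omega) hta)
  rcases le_or_gt (a + D.L) D.T with haT | haT
  · exact key (a + D.L - 1) (by omega) (h.slack_onPoint_of_mem (by omega) hta (by omega)
      (by omega) (by rw [h.rise_eq_of_min_up (by omega) hta haT]))
  · exact key (a + D.L + D.T) (by omega) (h.slack_onPoint_of_mem (by omega) hta (by omega)
      (by omega) (by rw [h.rise_eq_of_late hta haT (by omega)]; omega))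

end IsAdmissible
end MachineData

/-! ### Dimension of the face -/

namespace MachineData
namespace IsAdmissible

variable {D : MachineData} {t m n : ℤ} {S : Finset ℤ}

/-- A linear functional that vanishes on the feasible schedules satisfying the inequality with
equality, and on the always-on schedule whose generation is `C̄` except for a decrease in period
`t`, is zero. -/
theorem eq_zero_of_forall_tight (h : D.IsAdmissible t m n S) {ε : ℝ} (hε : 0 < ε)
    (hεV : ε ≤ D.V) (hεC : D.Clo + ε ≤ D.Chi) (g : Schedule D.T →ₗ[ℝ] ℝ)
    (hg : ∀ p ∈ D.P, D.slack t m n S p = 0 → g p = 0)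
    (hgt : g (D.allOn fun j => D.Chi - if j = t then ε else 0) = 0) : g = 0 := by
  have hL := h.one_le_L
  have hLt := h.L_lt_t
  have htT := h.t_le_T
  obtain ⟨A, B, C, hC, hsum⟩ := Schedule.exists_coeff g
  have hmem : ∀ i, (D.allOn fun j => D.Chi - if j = i then ε else 0) ∈ D.P := fun i => by
    refine allOn_mem_P h.one_le_ell h.Clo_nonneg ?_ ?_ ?_ ?_ hL <;> intro j <;>
      split_ifs <;> linarith
  have hallOn : ∀ x : ℤ → ℝ, g (D.allOn x) =
      ∑ i ∈ Finset.Icc 1 D.T, A i * x i + ∑ i ∈ Finset.Icc 1 D.T, B i := fun x => by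
    rw [hsum, Finset.sum_eq_zero (s := Finset.Icc 2 D.T) fun i _ => by rw [allOn_u, mul_zero],
      add_zero]
    refine congrArg₂ (· + ·) (Finset.sum_congr rfl fun i hi => ?_)
      (Finset.sum_congr rfl fun i hi => ?_)
    · rw [allOn_x x (Finset.mem_Icc.1 hi).1 (Finset.mem_Icc.1 hi).2]
    · rw [allOn_y x (Finset.mem_Icc.1 hi).1 (Finset.mem_Icc.1 hi).2, mul_one]
  -- decreasing the generation of the always-on schedule in one period other than `t`
  have hdip : ∀ i ∈ Finset.Icc 1 D.T,
      g (D.allOn fun j => D.Chi - if j = i then ε else 0) = 0 := fun i hi => by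
    by_cases hit : i = t
    · rw [hit, hgt]
    · refine hg _ (hmem i) ?_
      rw [slack_apply, h.upperBound_allOn, allOn_x _ (by omega) htT, if_neg (Ne.symm hit)]
      ring
  -- `T + 1` is no period: no decrease in generation at all
  have hfull : g (D.allOn fun j => D.Chi - if j = D.T + 1 then ε else 0) = 0 := by
    refine hg _ (hmem _) ?_
    rw [slack_apply, h.upperBound_allOn, allOn_x _ (by omega) htT, if_neg (by omega)]
    ring
  have hA : ∀ i ∈ Finset.Icc 1 D.T, A i = 0 := fun i hi => by
    have h1 := hdip i hi
    have h2 := hfull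
    rw [hallOn] at h1 h2
    simp only [mul_sub, Finset.sum_sub_distrib, mul_ite, mul_zero, Finset.sum_ite_eq', hi,
      if_true] at h1 h2
    rw [if_neg (by simp)] at h2
    have h3 : A i * ε = 0 := by linarith
    exact (mul_eq_zero.1 h3).resolve_right hε.ne'
  -- prefix sums of the coefficients of `y`
  set F : ℤ → ℝ := fun j => ∑ i ∈ Finset.Icc 1 D.T, if i ≤ j then B i else 0 with hF
  have hFT : ∀ j, D.T ≤ j → F j = 0 := fun j hj => by
    have h2 := hfull
    rw [hallOn, Finset.sum_eq_zero fun i hi => by rw [hA i hi, zero_mul], zero_add] at h2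
    rw [← h2]
    exact Finset.sum_congr rfl fun i hi => if_pos ((Finset.mem_Icc.1 hi).2.trans hj)
  have hF0 : ∀ j ≤ 0, F j = 0 := fun j hj => Finset.sum_eq_zero fun i hi =>
    if_neg (by have := Finset.mem_Icc.1 hi; omega)
  have hon : ∀ a b, a + D.L ≤ b + 1 → D.slack t m n S (D.onPoint a b) = 0 →
      F b - F (a - 1) + C a = 0 := fun a b hab hs => by
    have h1 := hg _ (onPoint_mem_P hL h.one_le_ell h.Clo_nonneg h.Clo_le_Vbar h.Vbar_le_Chi
      h.V_pos hab) hs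
    have h2 : ∑ i ∈ Finset.Icc 1 D.T, B i * (D.onPoint a b).y i = F b - F (a - 1) := by
      rw [hF, ← Finset.sum_sub_distrib]
      refine Finset.sum_congr rfl fun i hi => ?_
      rw [onPoint_y (Finset.mem_Icc.1 hi).1 (Finset.mem_Icc.1 hi).2]
      split_ifs <;> first | omega | simp
    have h3 : ∑ i ∈ Finset.Icc 2 D.T, C i * (D.onPoint a b).u i = C a := by
      rw [Finset.sum_congr rfl fun i hi => by
        rw [onPoint_u (Finset.mem_Icc.1 hi).1 (Finset.mem_Icc.1 hi).2, mul_ite, mul_one, mul_zero],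
        Finset.sum_ite_eq']
      split_ifs with ha
      · rfl
      · exact (hC a ha).symm
    rw [hsum, Finset.sum_eq_zero fun i hi => by rw [hA i hi, zero_mul], h2, h3, zero_add] at h1
    exact h1
  obtain ⟨hF', hC'⟩ := h.eq_zero_of_tight hF0 hFT hon
  have hB : ∀ i ∈ Finset.Icc 1 D.T, B i = 0 := fun i hi => by
    have h1 : F i - F (i - 1) = B i := by
      rw [hF, ← Finset.sum_sub_distrib, Finset.sum_eq_single_of_mem i hi]
      · simp
      · intro j _ hji
        split_ifs <;> first | omega | simp
    rw [← h1, hF', hF', sub_zero]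
  refine LinearMap.ext fun p => ?_
  rw [hsum, Finset.sum_eq_zero fun i hi => by rw [hA i hi, zero_mul],
    Finset.sum_eq_zero fun i hi => by rw [hB i hi, zero_mul],
    Finset.sum_eq_zero fun i _ => by rw [hC' i, zero_mul]]
  simp

theorem isValidIneq (h : D.IsAdmissible t m n S) :
    IsValidIneq (convexHull ℝ D.P) (fun p => p.x t) (D.upperBound t m n S) := by
  have hconv : Convex ℝ {p : Schedule D.T | 0 ≤ D.slack t m n S p} :=
    convex_halfSpace_ge (D.slack t m n S).isLinear 0
  have hsub : D.P ⊆ {p : Schedule D.T | 0 ≤ D.slack t m n S p} := fun p hp =>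
    sub_nonneg.2 (h.x_le_upperBound hp)
  exact fun p hp => sub_nonneg.1 (convexHull_min hsub hconv hp)

theorem isFacetDefining (h : D.IsAdmissible t m n S) (hC : D.Clo < D.Chi) :
    IsFacetDefining (convexHull ℝ D.P) (fun p => p.x t) (D.upperBound t m n S) := by
  set s := D.slack t m n S with hs
  set face := {p ∈ convexHull ℝ D.P | p.x t = D.upperBound t m n S p} with hface
  have hmem : ∀ p ∈ D.P, s p = 0 → p ∈ face := fun p hp hp0 =>
    ⟨subset_convexHull ℝ _ hp, (sub_eq_zero.1 hp0).symm⟩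
  have h0P := zero_mem_P h.Clo_le_Vbar h.Clo_nonneg
  have h0 : (0 : Schedule D.T) ∈ face := hmem 0 h0P (map_zero _)
  -- a feasible schedule off the face
  obtain ⟨ε, hε, hεV, hεC⟩ : ∃ ε > 0, ε ≤ D.V ∧ D.Clo + ε ≤ D.Chi :=
    ⟨min D.V (D.Chi - D.Clo), lt_min h.V_pos (sub_pos.2 hC), min_le_left _ _, by
      linarith [min_le_right D.V (D.Chi - D.Clo)]⟩
  set q := D.allOn fun j => D.Chi - if j = t then ε else 0 with hq
  have hqP : q ∈ D.P := by
    refine allOn_mem_P h.one_le_ell h.Clo_nonneg ?_ ?_ ?_ ?_ h.one_le_L <;> intro j <;>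
      split_ifs <;> linarith
  have hsq : s q = ε := by
    rw [hs, slack_apply, h.upperBound_allOn,
      allOn_x _ (by have := h.L_lt_t; have := h.one_le_L; omega) h.t_le_T, if_pos rfl]
    ring
  have hsub : ∀ p, p - (s p / ε) • q ∈ LinearMap.ker s := fun p => by
    rw [LinearMap.mem_ker, map_sub, map_smul, hsq, smul_eq_mul, div_mul_cancel₀ _ hε.ne', sub_self]
  have hle : LinearMap.ker s ≤ vectorSpan ℝ face := by
    intro v hv
    by_contra hvn
    obtain ⟨f, hfv, hf⟩ := Submodule.exists_le_ker_of_notMem hvn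
    have hff : ∀ p ∈ face, f p = 0 := fun p hp => by
      have := hf (vsub_mem_vectorSpan ℝ hp h0)
      rwa [vsub_eq_sub, sub_zero] at this
    -- subtracting a multiple of `s` makes the functional vanish at `q` as well
    have hg := h.eq_zero_of_forall_tight hε hεV hεC (f - (f q / ε) • s)
      (fun p hp hp0 => by
        rw [LinearMap.sub_apply, LinearMap.smul_apply, hp0, hff p (hmem p hp hp0)]; simp)
      (by rw [LinearMap.sub_apply, LinearMap.smul_apply, hsq, smul_eq_mul,
        div_mul_cancel₀ _ hε.ne', sub_self])
    have h1 := LinearMap.congr_fun hg v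
    rw [LinearMap.sub_apply, LinearMap.smul_apply, LinearMap.mem_ker.1 hv, smul_zero,
      sub_zero] at h1
    exact hfv h1
  have hge : vectorSpan ℝ face ≤ LinearMap.ker s := by
    refine Submodule.span_le.2 ?_
    rintro _ ⟨p, hp, p', hp', rfl⟩
    have h1 : s p = 0 := sub_eq_zero.2 hp.2.symm
    have h2 : s p' = 0 := sub_eq_zero.2 hp'.2.symm
    simp [h1, h2]
  have htop : vectorSpan ℝ (convexHull ℝ D.P) = ⊤ := by
    have hle' : LinearMap.ker s ≤ vectorSpan ℝ (convexHull ℝ D.P) :=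
      hle.trans (vectorSpan_mono ℝ fun p hp => hp.1)
    have hq' : q ∈ vectorSpan ℝ (convexHull ℝ D.P) := by
      have := vsub_mem_vectorSpan ℝ (subset_convexHull ℝ _ hqP) (subset_convexHull ℝ _ h0P)
      rwa [vsub_eq_sub, sub_zero] at this
    refine eq_top_iff.2 fun p _ => ?_
    have := add_mem (hle' (hsub p)) (Submodule.smul_mem _ (s p / ε) hq')
    rwa [sub_add_cancel] at this
  refine ⟨h.isValidIneq, ⟨0, h0⟩, ?_⟩
  change Module.finrank ℝ (vectorSpan ℝ face) + 1 = _
  rw [le_antisymm hge hle, htop, finrank_top]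
  refine Module.Dual.finrank_ker_add_one_of_ne_zero fun hs0 => hε.ne' ?_
  rw [← hsq, hs0, LinearMap.zero_apply]

end IsAdmissible
end MachineData

/-! ### The inequality is valid and facet-defining -/

theorem mainTheorem8 (D : MachineData)
    (hL : 1 ≤ D.L) (hell : 1 ≤ D.ell) (hellT : D.ell + 1 ≤ D.T)
    (hClo : 0 ≤ D.Clo) (hCloV : D.Clo ≤ D.Vbar) (hVChi : D.Vbar ≤ D.Chi) (hV : 0 < D.V)
    (t m n : ℤ) (S : Finset ℤ)
    (ht : t ∈ Finset.Icc (D.L + 1) D.T)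
    (hm0 : 0 ≤ m) (hmt : m ≤ t - D.L - 1)
    (hmC : (m : ℝ) ≤ (D.Chi - D.Vbar) / D.V - (D.L : ℝ) + 1)
    (hn : (2 ≤ D.L ∧ n ∈ Finset.Icc (min 1 (D.T - t)) (min (D.L - 1) (D.T - t))) ∨
      (D.L = 1 ∧ n = 0))
    (hS : S ⊆ Finset.Icc (t - m + 1) t)
    (hcond : n ≤ D.T - t - 1 → ((D.L : ℝ) - 1) / 2 ≤ (n : ℝ)) :
    IsValidIneq (convexHull ℝ D.P) (fun p => p.x t) (D.upperBound t m n S) ∧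
    (D.Clo < D.Chi →
      IsFacetDefining (convexHull ℝ D.P) (fun p => p.x t) (D.upperBound t m n S)) := by
  rw [Finset.mem_Icc] at ht
  rw [Finset.mem_Icc] at hn
  have hβ : 0 ≤ D.beta m := by
    have h1 : ((m : ℝ) + D.L - 1) * D.V ≤ D.Chi - D.Vbar :=
      (le_div_iff₀ hV).1 (by linarith)
    rw [MachineData.beta]
    push_cast
    linarith
  have hhalf : t + n + 1 ≤ D.T → D.L - 1 ≤ 2 * n := fun h => by
    have h1 := hcond (by omega)
    have h2 : (D.L : ℝ) - 1 ≤ 2 * n := by linarith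
    exact_mod_cast h2
  have h : D.IsAdmissible t m n S :=
    { one_le_L := hL
      one_le_ell := hell
      ell_lt_T := hellT
      Clo_nonneg := hClo
      Clo_le_Vbar := hCloV
      Vbar_le_Chi := hVChi
      V_pos := hV
      L_lt_t := ht.1
      t_le_T := ht.2
      m_nonneg := hm0
      L_lt_sub := by omega
      beta_nonneg := hβ
      n_nonneg := by omega
      n_le_L := by omega
      n_le_T := by omega
      n_half := hhalf
      lt_of_mem := fun i hi => by have := Finset.mem_Icc.1 (hS hi); omega
      le_of_mem := fun i hi => (Finset.mem_Icc.1 (hS hi)).2 }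
  exact ⟨h.isValidIneq, h.isFacetDefining⟩
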